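/- Let $\mathbb{D}$ be the open unit disc of $\mathbb{C}$, and let $A$ be an analytic function in $\mathbb{D}$ with $A\in H^\infty_2$, that is, $\sup_{z\in\mathbb{D}}(1-|z|^2)^2|A(z)|<\infty$. Let $f\not\equiv 0$ be an analytic solution of $f''+Af=0$ in $\mathbb{D}$, and let $\{z_n\}$ be the (finite or infinite, possibly empty) sequence of all zeros of $f$ in $\mathbb{D}$; a supremum over the empty set is regarded as finite. Then the following conditions are equivalent: (i) $f$ is normal in the sense of Lehto and Virtanen, that is, $\displaystyle\sup_{z\in\mathbb{D}}\,(1-|z|^2)\,\frac{|f'(z)|}{1+|f(z)|^2}<\infty$; (ii) $\displaystyle\sup_{n}\,(1-|z_n|^2)\,|f'(z_n)|<\infty$; (iii) there exists a constant $c$ with $0<c<1$ such that $f$ is uniformly bounded in $\bigcup_{n} D\big(z_n,c(1-|z_n|)\big)$, where $D(a,r)=\{z\in\mathbb{C}:|z-a|<r\}$. -/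

import Mathlib

namespace NormalODE

/-- The open unit disc of the complex plane. -/
def disc : Set ℂ := Metric.ball (0 : ℂ) 1

/-- Membership of `A` in the growth space `H^∞_α`: `A` is analytic in the unit disc and
`(1 - |z|²)^α |A(z)|` is bounded there. Only the values of `A` in the disc matter. -/
def MemGrowthSpace (α : ℝ) (A : ℂ → ℂ) : Prop :=
  DifferentiableOn ℂ A disc ∧
    BddAbove ((fun z : ℂ => (1 - ‖z‖ ^ 2) ^ α * ‖A z‖) '' disc)

/-- `f` is an analytic solution of `f'' + A f = 0` in the unit disc. -/
def IsSolution (A f : ℂ → ℂ) : Prop :=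
  DifferentiableOn ℂ f disc ∧
    ∀ z ∈ disc, deriv (deriv f) z + A z * f z = 0

/-- The set of zeros of `f` in the unit disc. -/
def zeros (f : ℂ → ℂ) : Set ℂ := {z | z ∈ disc ∧ f z = 0}

/-- A meromorphic function `f` in the unit disc is normal in the sense of Lehto and Virtanen if
`(1 - |z|²) |f'(z)| / (1 + |f(z)|²)` is bounded in the disc. The bound is required at the points
of analyticity of `f`; the remaining points are isolated, and the quantity extends to them
continuously, so that they do not change the supremum. -/
def IsNormalFunction (f : ℂ → ℂ) : Prop :=
  MeromorphicOn f disc ∧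
    BddAbove ((fun z : ℂ => (1 - ‖z‖ ^ 2) * (‖deriv f z‖ / (1 + ‖f z‖ ^ 2))) ''
      {z | z ∈ disc ∧ AnalyticAt ℂ f z})

end NormalODE

namespace NormalODE

/-! The growth of `A` makes the equation scale-invariant: on `D(a, δ(1 - |a|))`, with `δ` depending
only on `A`, a solution is nearly its linearization at `a`. If `(1 - |a|)|f'(a)|` is at most a
constant times `|f(a)|`, the normality quotient at `a` is bounded outright. Otherwise `f` has a zero
`b` in that disc with `f'(b)` comparable to `f'(a)`, so the bound at the zeros controls `a`.
Conversely the quotient at a zero is exactly the quantity in (ii). Between (ii) and (iii), one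
direction is the same local estimate and the other is Cauchy's. -/

lemma isOpen_disc : IsOpen disc := Metric.isOpen_ball

lemma mem_disc {z : ℂ} : z ∈ disc ↔ ‖z‖ < 1 := by simp [disc]

/-- On a disc whose radius is small relative to the coefficient, a solution of `f'' + A f = 0` is
controlled by its value and derivative at the centre, and is close to its linearization. -/
lemma solution_estimates {A f : ℂ → ℂ} {U : Set ℂ} (hU : IsOpen U) (hf : DifferentiableOn ℂ f U)
    (hODE : ∀ z ∈ U, deriv (deriv f) z + A z * f z = 0) {a : ℂ} {R L : ℝ} (hR : 0 < R)
    (hsub : Metric.closedBall a R ⊆ U) (hA : ∀ z ∈ Metric.closedBall a R, ‖A z‖ ≤ L)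
    (hL : L * R ^ 2 ≤ 1 / 8) {z : ℂ} (hz : z ∈ Metric.closedBall a R) :
    ‖f z‖ ≤ 2 * (‖f a‖ + R * ‖deriv f a‖) ∧
    R * ‖deriv f z - deriv f a‖ ≤ (‖f a‖ + R * ‖deriv f a‖) / 4 ∧
    ‖f z - f a - deriv f a * (z - a)‖ ≤ (‖f a‖ + R * ‖deriv f a‖) / 4 := by
  have hfd : ∀ w ∈ U, DifferentiableAt ℂ f w := fun w hw => hf.differentiableAt (hU.mem_nhds hw)
  have hfd' : ∀ w ∈ U, DifferentiableAt ℂ (deriv f) w := fun w hw =>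
    (hf.deriv hU).differentiableAt (hU.mem_nhds hw)
  have ha : a ∈ Metric.closedBall a R := Metric.mem_closedBall_self hR.le
  have hL0 : 0 ≤ L := (norm_nonneg _).trans (hA a ha)
  obtain ⟨w, hw, hmax⟩ := (isCompact_closedBall a R).exists_isMaxOn ⟨a, ha⟩
    (hf.continuousOn.mono hsub).norm
  set S := ‖f w‖ with hS
  have hS0 : 0 ≤ S := norm_nonneg _
  have hle : ∀ u ∈ Metric.closedBall a R, ‖f u‖ ≤ S := fun u hu => hmax hu
  have hdist : ∀ u ∈ Metric.closedBall a R, ‖u - a‖ ≤ R := fun u hu => by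
    simpa [dist_eq_norm] using hu
  have hderiv2 : ∀ u ∈ Metric.closedBall a R, ‖deriv (deriv f) u‖ ≤ L * S := fun u hu => by
    rw [eq_neg_of_add_eq_zero_left (hODE u (hsub hu)), norm_neg, norm_mul]
    exact mul_le_mul (hA u hu) (hle u hu) (norm_nonneg _) hL0
  have hderiv1 : ∀ u ∈ Metric.closedBall a R, ‖deriv f u - deriv f a‖ ≤ L * S * R := fun u hu =>
    ((convex_closedBall a R).norm_image_sub_le_of_norm_deriv_le
      (fun x hx => hfd' x (hsub hx)) hderiv2 ha hu).trans
      (mul_le_mul_of_nonneg_left (hdist u hu) (by positivity))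
  have hlin : ∀ u ∈ Metric.closedBall a R,
      ‖f u - f a - deriv f a * (u - a)‖ ≤ L * S * R * R := fun u hu => by
    have h := (convex_closedBall a R).norm_image_sub_le_of_norm_hasDerivWithin_le
      (f := fun x => f x - deriv f a * x) (f' := fun x => deriv f x - deriv f a)
      (fun x hx => ((hfd x (hsub hx)).hasDerivAt.sub
        (by simpa using (hasDerivAt_id x).const_mul (deriv f a))).hasDerivWithinAt)
      hderiv1 ha hu
    calc ‖f u - f a - deriv f a * (u - a)‖
        = ‖f u - deriv f a * u - (f a - deriv f a * a)‖ := by congr 1; ring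
      _ ≤ L * S * R * ‖u - a‖ := h
      _ ≤ L * S * R * R := mul_le_mul_of_nonneg_left (hdist u hu) (by positivity)
  -- The smallness of `L * R ^ 2` lets the maximum `S` be absorbed: `S ≤ (8/7)(|f a| + R |f' a|)`.
  have hLS : L * S * R * R ≤ S / 8 := by nlinarith
  have hSle : S ≤ ‖f a‖ + R * ‖deriv f a‖ + S / 8 := by
    have h1 : S ≤ ‖f w - f a - deriv f a * (w - a)‖ + ‖f a‖ + ‖deriv f a * (w - a)‖ := by
      have := norm_add₃_le (a := f w - f a - deriv f a * (w - a)) (b := f a)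
        (c := deriv f a * (w - a))
      rwa [show f w - f a - deriv f a * (w - a) + f a + deriv f a * (w - a) = f w by ring] at this
    have h2 : ‖deriv f a * (w - a)‖ ≤ R * ‖deriv f a‖ := by
      rw [norm_mul, mul_comm]
      exact mul_le_mul_of_nonneg_right (hdist w hw) (norm_nonneg _)
    linarith [hlin w hw]
  refine ⟨by linarith [hle z hz], ?_, by linarith [hlin z hz]⟩
  have := mul_le_mul_of_nonneg_left (hderiv1 z hz) hR.le
  linarith

/-- If the derivative dominates the value at the centre and the function is close to its
linearization on a disc, then it has a zero in that disc. -/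
lemma exists_zero_of_near_linear {f : ℂ → ℂ} {U : Set ℂ}
    (hf : DifferentiableOn ℂ f U) {a : ℂ} {R : ℝ} (hR : 0 < R) (hsub : Metric.closedBall a R ⊆ U)
    (hlin : ∀ z ∈ Metric.closedBall a R,
      ‖f z - f a - deriv f a * (z - a)‖ ≤ (‖f a‖ + R * ‖deriv f a‖) / 4)
    (hdom : 4 * ‖f a‖ < R * ‖deriv f a‖) :
    ∃ b ∈ Metric.closedBall a R, f b = 0 := by
  have hd : DiffContOnCl ℂ f (Metric.ball a R) :=
    DifferentiableOn.diffContOnCl ((hf.mono hsub).mono Metric.closure_ball_subset_closedBall)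
  -- Here `11/16 = 1 - (1 + 1/4)/4`, using `hdom`.
  have hsphere : ∀ z ∈ Metric.sphere a R, 11 / 16 * (R * ‖deriv f a‖) ≤ ‖f z - f a‖ := by
    intro z hz
    have h1 := hlin z (Metric.sphere_subset_closedBall hz)
    have h2 : ‖deriv f a * (z - a)‖ = R * ‖deriv f a‖ := by
      rw [norm_mul, mul_comm, ← dist_eq_norm, Metric.mem_sphere.1 hz]
    have h3 := norm_sub_norm_le (deriv f a * (z - a)) (f z - f a)
    rw [norm_sub_rev (deriv f a * (z - a))] at h3
    linarith
  have hne : ∃ᶠ z in nhds a, f z ≠ f a := by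
    intro h
    have h' : f =ᶠ[nhds a] fun _ => f a := by
      filter_upwards [h] with z hz using not_not.1 hz
    have h0 : deriv f a = 0 := by rw [h'.deriv_eq]; simp
    rw [h0] at hdom
    simp only [norm_zero, mul_zero] at hdom
    linarith [norm_nonneg (f a)]
  -- Quantitative open mapping: the image contains a disc about `f a` of radius `11/32 * R |f' a|`,
  -- which exceeds `|f a|`.
  have h := hd.ball_subset_image_closedBall hR hsphere hne
  have h0 : (0 : ℂ) ∈ Metric.ball (f a) (11 / 16 * (R * ‖deriv f a‖) / 2) := by
    rw [Metric.mem_ball, dist_zero_left]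
    linarith [norm_nonneg (f a)]
  exact h h0

lemma closedBall_subset_disc {a : ℂ} (ha : a ∈ disc) {δ : ℝ} (hδ : δ ≤ 1 / 2) {z : ℂ}
    (hz : z ∈ Metric.closedBall a (δ * (1 - ‖a‖))) : (1 - ‖a‖) / 2 ≤ 1 - ‖z‖ ∧ z ∈ disc := by
  rw [mem_disc] at *
  rw [mem_closedBall_iff_norm] at hz
  have := norm_sub_norm_le z a
  have h : (1 - ‖a‖) / 2 ≤ 1 - ‖z‖ := by nlinarith
  exact ⟨h, by linarith⟩

lemma one_sub_norm_le {z : ℂ} (hz : z ∈ disc) : 1 - ‖z‖ ≤ 1 - ‖z‖ ^ 2 := by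
  rw [mem_disc] at hz
  nlinarith [norm_nonneg z]

lemma one_sub_norm_sq_le {z : ℂ} : 1 - ‖z‖ ^ 2 ≤ 2 * (1 - ‖z‖) := by
  nlinarith [sq_nonneg (1 - ‖z‖)]

/-- For a coefficient in `H^∞_2` the local estimates hold on all discs `D(a, δ(1 - |a|))`, with
`δ` depending on the coefficient only. -/
lemma exists_uniform_estimates {A f : ℂ → ℂ} (hA : MemGrowthSpace 2 A) (hf : IsSolution A f) :
    ∃ δ : ℝ, 0 < δ ∧ δ ≤ 1 / 2 ∧ ∀ a ∈ disc, ∀ z ∈ Metric.closedBall a (δ * (1 - ‖a‖)),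
      ‖f z‖ ≤ 2 * (‖f a‖ + δ * (1 - ‖a‖) * ‖deriv f a‖) ∧
      δ * (1 - ‖a‖) * ‖deriv f z - deriv f a‖ ≤
        (‖f a‖ + δ * (1 - ‖a‖) * ‖deriv f a‖) / 4 ∧
      ‖f z - f a - deriv f a * (z - a)‖ ≤ (‖f a‖ + δ * (1 - ‖a‖) * ‖deriv f a‖) / 4 := by
  obtain ⟨-, K, hK⟩ := hA
  have hK' : ∀ z ∈ disc, (1 - ‖z‖ ^ 2) ^ 2 * ‖A z‖ ≤ K := fun z hz => by
    simpa using hK (Set.mem_image_of_mem _ hz)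
  have hK0 : 0 ≤ K := le_trans (by positivity) (hK' 0 (by simp [disc]))
  have hδ : 1 / (2 * (1 + 4 * K)) ≤ (1 / 2 : ℝ) :=
    one_div_le_one_div_of_le (by norm_num) (by linarith)
  -- On the disc `|A| ≤ 4K / (1 - |a|)^2`, so smallness means `4Kδ² ≤ 1/8`; since `4Kδ + δ = 1/2`,
  -- AM-GM even gives `1/16`.
  refine ⟨1 / (2 * (1 + 4 * K)), by positivity, hδ, fun a ha z hz => ?_⟩
  set δ := 1 / (2 * (1 + 4 * K)) with hδdef
  have hδ0 : 0 < δ := by positivity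
  have hpos : 0 < 1 - ‖a‖ := by linarith [mem_disc.1 ha]
  refine solution_estimates (L := 4 * K / (1 - ‖a‖) ^ 2) isOpen_disc hf.1 hf.2 (mul_pos hδ0 hpos)
    (fun w hw => (closedBall_subset_disc ha hδ hw).2) (fun w hw => ?_) ?_ hz
  · obtain ⟨h1, h2⟩ := closedBall_subset_disc ha hδ hw
    rw [le_div_iff₀ (by positivity)]
    have h3 : ((1 - ‖a‖) / 2) ^ 2 ≤ (1 - ‖w‖ ^ 2) ^ 2 :=
      pow_le_pow_left₀ (by linarith) (h1.trans (one_sub_norm_le h2)) 2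
    nlinarith [hK' w h2, mul_le_mul_of_nonneg_right h3 (norm_nonneg (A w))]
  · have h1 : 4 * K / (1 - ‖a‖) ^ 2 * (δ * (1 - ‖a‖)) ^ 2 = 4 * K * δ * δ := by
      field_simp
    have h2 : 4 * K * δ ≤ 1 / 2 := by
      rw [hδdef, mul_one_div, div_le_iff₀ (by positivity)]
      linarith
    have h3 : δ * (1 + 4 * K) = 1 / 2 := by
      rw [hδdef]; field_simp
    rw [h1]
    nlinarith [sq_nonneg (4 * K * δ - δ)]

lemma derivative_bound_of_bounded_near_zeros {f : ℂ → ℂ} (hf : DifferentiableOn ℂ f disc)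
    {c C : ℝ} (hc : 0 < c) (hc1 : c < 1)
    (hC : ∀ z ∈ ⋃ a ∈ zeros f, Metric.ball a (c * (1 - ‖a‖)), ‖f z‖ ≤ C) :
    BddAbove ((fun z : ℂ => (1 - ‖z‖ ^ 2) * ‖deriv f z‖) '' zeros f) := by
  refine ⟨2 * (C / (c / 2)), ?_⟩
  rintro _ ⟨a, ha, rfl⟩
  have hpos : 0 < 1 - ‖a‖ := by linarith [mem_disc.1 ha.1]
  -- Halving the radius puts the Cauchy circle inside the open disc where `f` is bounded.
  have hsub : Metric.closedBall a (c / 2 * (1 - ‖a‖)) ⊆ disc := fun z hz =>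
    (closedBall_subset_disc ha.1 (by linarith) hz).2
  have hCauchy := Complex.norm_deriv_le_of_forall_mem_sphere_norm_le
    (c := a) (R := c / 2 * (1 - ‖a‖)) (C := C) (f := f) (by positivity)
    (DifferentiableOn.diffContOnCl
      ((hf.mono hsub).mono Metric.closure_ball_subset_closedBall))
    (fun z hz => hC z (Set.mem_biUnion ha (by
      rw [Metric.mem_ball, Metric.mem_sphere.1 hz]
      nlinarith [mul_pos hc hpos])))
  calc (1 - ‖a‖ ^ 2) * ‖deriv f a‖ ≤ 2 * (1 - ‖a‖) * (C / (c / 2 * (1 - ‖a‖))) :=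
        mul_le_mul one_sub_norm_sq_le hCauchy (norm_nonneg _) (by positivity)
    _ = 2 * (C / (c / 2)) := by field_simp

lemma bounded_near_zeros_of_derivative_bound {A f : ℂ → ℂ} (hA : MemGrowthSpace 2 A)
    (hf : IsSolution A f)
    (h : BddAbove ((fun z : ℂ => (1 - ‖z‖ ^ 2) * ‖deriv f z‖) '' zeros f)) :
    ∃ c : ℝ, 0 < c ∧ c < 1 ∧ ∃ C : ℝ,
      ∀ z ∈ ⋃ a ∈ zeros f, Metric.ball a (c * (1 - ‖a‖)), ‖f z‖ ≤ C := by
  obtain ⟨δ, hδ0, hδ, hest⟩ := exists_uniform_estimates hA hf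
  obtain ⟨B, hB⟩ := h
  refine ⟨δ, hδ0, by linarith, 2 * B, fun z hz => ?_⟩
  obtain ⟨a, ha, hza⟩ := Set.mem_iUnion₂.1 hz
  have h1 := (hest a ha.1 z (Metric.ball_subset_closedBall hza)).1
  have h2 : (1 - ‖a‖ ^ 2) * ‖deriv f a‖ ≤ B := hB (Set.mem_image_of_mem _ ha)
  have hpos : 0 < 1 - ‖a‖ := by linarith [mem_disc.1 ha.1]
  have h3 : δ * (1 - ‖a‖) * ‖deriv f a‖ ≤ (1 - ‖a‖ ^ 2) * ‖deriv f a‖ :=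
    mul_le_mul_of_nonneg_right (by nlinarith [one_sub_norm_le ha.1]) (norm_nonneg _)
  rw [ha.2, norm_zero] at h1
  linarith

lemma derivative_bound_of_isNormalFunction {f : ℂ → ℂ} (hf : DifferentiableOn ℂ f disc)
    (h : IsNormalFunction f) :
    BddAbove ((fun z : ℂ => (1 - ‖z‖ ^ 2) * ‖deriv f z‖) '' zeros f) := by
  obtain ⟨-, B, hB⟩ := h
  refine ⟨B, ?_⟩
  rintro _ ⟨a, ha, rfl⟩
  simpa [ha.2] using
    hB (Set.mem_image_of_mem _ ⟨ha.1, hf.analyticAt (isOpen_disc.mem_nhds ha.1)⟩)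

lemma isNormalFunction_of_derivative_bound {A f : ℂ → ℂ} (hA : MemGrowthSpace 2 A)
    (hf : IsSolution A f)
    (h : BddAbove ((fun z : ℂ => (1 - ‖z‖ ^ 2) * ‖deriv f z‖) '' zeros f)) :
    IsNormalFunction f := by
  obtain ⟨δ, hδ0, hδ, hest⟩ := exists_uniform_estimates hA hf
  obtain ⟨B, hB⟩ := h
  refine ⟨fun z hz => (hf.1.analyticAt (isOpen_disc.mem_nhds hz)).meromorphicAt,
    -- `8 / δ` serves where `f` dominates its derivative; `6 ≥ 64/11 = 2 * 2 * 16/11` serves near a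
    -- zero.
    max (8 / δ) (6 * B), ?_⟩
  rintro _ ⟨a, ⟨ha, -⟩, rfl⟩
  have hpos : 0 < 1 - ‖a‖ := by linarith [mem_disc.1 ha]
  have hR : 0 < δ * (1 - ‖a‖) := mul_pos hδ0 hpos
  have hsq : (1 - ‖a‖ ^ 2) * ‖deriv f a‖ ≤ 2 * (1 - ‖a‖) * ‖deriv f a‖ :=
    mul_le_mul_of_nonneg_right one_sub_norm_sq_le (norm_nonneg _)
  change (1 - ‖a‖ ^ 2) * (‖deriv f a‖ / (1 + ‖f a‖ ^ 2)) ≤ _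
  rw [← mul_div_assoc, div_le_iff₀ (by positivity)]
  rcases le_or_gt (δ * (1 - ‖a‖) * ‖deriv f a‖) (4 * ‖f a‖) with hdom | hdom
  · have h1 : 2 * (1 - ‖a‖) * ‖deriv f a‖ ≤ 8 / δ * ‖f a‖ := by
      rw [div_mul_eq_mul_div, le_div_iff₀ hδ0]
      linarith
    have h2 : ‖f a‖ ≤ 1 + ‖f a‖ ^ 2 := by nlinarith [sq_nonneg (‖f a‖ - 1)]
    calc (1 - ‖a‖ ^ 2) * ‖deriv f a‖ ≤ 8 / δ * ‖f a‖ := hsq.trans h1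
      _ ≤ max (8 / δ) (6 * B) * (1 + ‖f a‖ ^ 2) :=
        mul_le_mul (le_max_left _ _) h2 (norm_nonneg _)
          (le_max_of_le_left (by positivity))
  · obtain ⟨b, hb, hfb⟩ := exists_zero_of_near_linear hf.1 hR
      (fun w hw => (closedBall_subset_disc ha hδ hw).2) (fun z hz => (hest a ha z hz).2.2) hdom
    obtain ⟨hb1, hb2⟩ := closedBall_subset_disc ha hδ hb
    have hBb : (1 - ‖b‖ ^ 2) * ‖deriv f b‖ ≤ B := hB (Set.mem_image_of_mem _ ⟨hb2, hfb⟩)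
    have h1 : 11 / 16 * ‖deriv f a‖ ≤ ‖deriv f b‖ := by
      have h2 := (hest a ha b hb).2.1
      -- By `hdom`, `(|f a| + R |f' a|)/4 ≤ (5/16) R |f' a|`.
      have h3 : ‖deriv f b - deriv f a‖ ≤ 5 / 16 * ‖deriv f a‖ :=
        le_of_mul_le_mul_left (by linarith) hR
      have h4 := norm_sub_norm_le (deriv f a) (deriv f b)
      rw [norm_sub_rev] at h4
      linarith
    have h5 : (1 - ‖a‖) / 2 * (11 / 16 * ‖deriv f a‖) ≤ B :=
      (mul_le_mul (hb1.trans (one_sub_norm_le hb2)) h1 (by positivity)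
        (by linarith [one_sub_norm_le hb2])).trans hBb
    have h6 : 0 ≤ (1 - ‖a‖) * ‖deriv f a‖ := by positivity
    calc (1 - ‖a‖ ^ 2) * ‖deriv f a‖ ≤ 6 * B * 1 := by linarith
      _ ≤ max (8 / δ) (6 * B) * (1 + ‖f a‖ ^ 2) :=
        mul_le_mul (le_max_right _ _) (by linarith [sq_nonneg ‖f a‖]) zero_le_one
          (le_max_of_le_left (by positivity))

end NormalODE

theorem mainTheorem7 (A f : ℂ → ℂ)
    (hA : NormalODE.MemGrowthSpace 2 A)
    (hf : NormalODE.IsSolution A f)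
    (hnontrivial : ∃ z ∈ NormalODE.disc, f z ≠ 0) :
    List.TFAE [
      NormalODE.IsNormalFunction f,
      BddAbove ((fun z : ℂ => (1 - ‖z‖ ^ 2) * ‖deriv f z‖) '' NormalODE.zeros f),
      ∃ c : ℝ, 0 < c ∧ c < 1 ∧ ∃ C : ℝ,
        ∀ z ∈ ⋃ a ∈ NormalODE.zeros f, Metric.ball a (c * (1 - ‖a‖)), ‖f z‖ ≤ C] := by
  tfae_have 1 → 2 := NormalODE.derivative_bound_of_isNormalFunction hf.1
  tfae_have 2 → 1 := NormalODE.isNormalFunction_of_derivative_bound hA hf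
  tfae_have 2 → 3 := NormalODE.bounded_near_zeros_of_derivative_bound hA hf
  tfae_have 3 → 2 := fun ⟨_, hc, hc1, _, hC⟩ =>
    NormalODE.derivative_bound_of_bounded_near_zeros hf.1 hc hc1 hC
  tfae_finish
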